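/- All matrices are real and have positive sizes; inequalities between matrices are entrywise. For a square matrix $A$ let $\rho(A)$ be its spectral radius, the maximal modulus of its complex eigenvalues. A set of $N\times M$ matrices is an IRU-set (independent row uncertainty) if there are sets of rows $\mathscr{R}_1,\dots,\mathscr{R}_N\subseteq\mathbb{R}^M$ such that it consists of all the matrices whose $i$-th row lies in $\mathscr{R}_i$ for $i=1,\dots,N$. A finite set of matrices is linearly ordered if it can be written as $\{A_1,\dots,A_m\}$ with $A_1\le A_2\le\dots\le A_m$. For sets of matrices of suitable sizes put $\mathscr{A}+\mathscr{B}=\{A+B: A\in\mathscr{A},\,B\in\mathscr{B}\}$, $\mathscr{A}\mathscr{B}=\{AB: A\in\mathscr{A},\,B\in\mathscr{B}\}$ and $t\mathscr{A}=\{tA: A\in\mathscr{A}\}$ for $t\in\mathbb{R}$. Let $\mathscr{A}_1,\dots,\mathscr{A}_n$ be non-empty sets of non-negative matrices, where $\mathscr{A}_i$ consists of $N_i\times M_i$ matrices and is either a finite linearly ordered set or a compact IRU-set. Let $W$ be a non-empty finite set of non-empty words $w=(i_1,\dots,i_k)$ over $\{1,\dots,n\}$ such that the product $\mathscr{A}_{i_1}\cdots\mathscr{A}_{i_k}$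 is defined and consists of $N\times N$ matrices, let $p_w>0$ for $w\in W$, and let $$\mathscr{A}=\sum_{w=(i_1,\dots,i_k)\in W}p_w\,\mathscr{A}_{i_1}\mathscr{A}_{i_2}\cdots\mathscr{A}_{i_k}.$$ Let $\tilde{\mathscr{A}}$ be a compact set with $\mathscr{A}\subseteq\tilde{\mathscr{A}}\subseteq\operatorname{co}(\mathscr{A})$, where $\operatorname{co}$ is the convex hull. For $\mathscr{S}\in\{\mathscr{A},\tilde{\mathscr{A}}\}$ write $$\rho_{min}(\mathscr{S})=\min_{A\in\mathscr{S}}\rho(A),\qquad \rho_{max}(\mathscr{S})=\max_{A\in\mathscr{S}}\rho(A);$$ these minima and maxima exist. For $k\ge1$ let $$\check\rho_k(\tilde{\mathscr{A}})=\inf_{A_i\in\tilde{\mathscr{A}}}\rho(A_k\cdots A_1)^{1/k},\qquad \hat\rho_k(\tilde{\mathscr{A}})=\sup_{A_i\in\tilde{\mathscr{A}}}\rho(A_k\cdots A_1)^{1/k}.$$ Let $\check\rho(\tilde{\mathscr{A}})=\lim_{k\to\infty}\inf_{A_i\in\tilde{\mathscr{A}}}\|A_k\cdots A_1\|^{1/k}=\inf_{k\ge1}\inf_{A_i\in\tilde{\mathscr{A}}}\|A_k\cdots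 A_1\|^{1/k}$ be the lower spectral radius, where $\|\cdot\|$ is the matrix norm induced by an arbitrary norm on $\mathbb{R}^N$, and let $\hat\rho(\tilde{\mathscr{A}})=\lim_{k\to\infty}\hat\rho_k(\tilde{\mathscr{A}})=\sup_{k\ge1}\hat\rho_k(\tilde{\mathscr{A}})$ be the generalized spectral radius; these limits exist and have the stated values, and also $\check\rho(\tilde{\mathscr{A}})=\lim_{k\to\infty}\check\rho_k(\tilde{\mathscr{A}})$. Then: (i) $\check\rho_k(\tilde{\mathscr{A}})=\rho_{min}(\mathscr{A})$ for all $k\ge1$, and $\check\rho(\tilde{\mathscr{A}})=\rho_{min}(\tilde{\mathscr{A}})=\rho_{min}(\mathscr{A})$; (ii) $\hat\rho_k(\tilde{\mathscr{A}})=\rho_{max}(\mathscr{A})$ for all $k\ge1$, and $\hat\rho(\tilde{\mathscr{A}})=\rho_{max}(\tilde{\mathscr{A}})=\rho_{max}(\mathscr{A})$. -/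

import Mathlib

open Filter Topology
open scoped Pointwise

noncomputable section

namespace MatrixSets

/-! ### Sets of matrices -/

/-- A set of entrywise non-negative matrices. -/
def IsNonnegSet {N M : ℕ} (S : Set (Matrix (Fin N) (Fin M) ℝ)) : Prop :=
  ∀ A ∈ S, ∀ i j, 0 ≤ A i j

/-- A finite set of matrices that is linearly ordered by the entrywise order. -/
def IsFiniteLinearlyOrdered {N M : ℕ} (S : Set (Matrix (Fin N) (Fin M) ℝ)) : Prop :=
  S.Finite ∧ IsChain (fun A B => ∀ i j, A i j ≤ B i j) S

/-- A set with independent row uncertainty: all the matrices whose `i`-th row belongs to a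
given set of rows `R i`, for each `i`. -/
def IsIRU {N M : ℕ} (S : Set (Matrix (Fin N) (Fin M) ℝ)) : Prop :=
  ∃ R : Fin N → Set (Fin M → ℝ), S = {A | ∀ i, A.row i ∈ R i}

/-! ### Minkowski polynomials -/

/-- Given arguments of sizes `r i × c i`, the non-empty words `i₁ i₂ ⋯ iₖ` whose products are
admissible (`c i₁ = r i₂`, and so on). The indices of the family are the sizes of the product,
`N = r i₁` and `M = c iₖ`. -/
inductive AdmissibleWord {n : ℕ} (r c : Fin n → ℕ) : ℕ → ℕ → Type
  | single (i : Fin n) : AdmissibleWord r c (r i) (c i)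
  | cons (i : Fin n) {M : ℕ} (w : AdmissibleWord r c (c i) M) : AdmissibleWord r c (r i) M

/-- The Minkowski product `𝒜 i₁ 𝒜 i₂ ⋯ 𝒜 iₖ` along an admissible word. -/
def AdmissibleWord.eval {n : ℕ} {r c : Fin n → ℕ}
    (𝒜 : (i : Fin n) → Set (Matrix (Fin (r i)) (Fin (c i)) ℝ)) :
    {N M : ℕ} → AdmissibleWord r c N M → Set (Matrix (Fin N) (Fin M) ℝ)
  | _, _, .single i => 𝒜 i
  | _, _, .cons i w => Set.image2 (fun A B => A * B) (𝒜 i) (w.eval 𝒜)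

/-- The value of the polynomial with words `W` and coefficients `p`: the Minkowski sum over the
words `w ∈ W` of the sets `p w • 𝒜 i₁ 𝒜 i₂ ⋯ 𝒜 iₖ`. -/
def minkowskiPolynomial {n : ℕ} {r c : Fin n → ℕ} {N M : ℕ}
    (W : Finset (AdmissibleWord r c N M)) (p : AdmissibleWord r c N M → ℝ)
    (𝒜 : (i : Fin n) → Set (Matrix (Fin (r i)) (Fin (c i)) ℝ)) :
    Set (Matrix (Fin N) (Fin M) ℝ) :=
  ∑ w ∈ W, p w • w.eval 𝒜

/-! ### Spectral characteristics -/

/-- The spectral radius of a real square matrix: the maximal modulus of its complex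
eigenvalues. -/
def rho {N : ℕ} (A : Matrix (Fin N) (Fin N) ℝ) : ℝ :=
  (spectralRadius ℂ (A.map Complex.ofReal)).toReal

/-- `ρ_min`, the infimum of `rho` over a set of matrices. -/
def rhoMin {N : ℕ} (S : Set (Matrix (Fin N) (Fin N) ℝ)) : ℝ := sInf (rho '' S)

/-- `ρ_max`, the supremum of `rho` over a set of matrices. -/
def rhoMax {N : ℕ} (S : Set (Matrix (Fin N) (Fin N) ℝ)) : ℝ := sSup (rho '' S)

/-- The numbers `f (Aₙ ⋯ A₁) ^ (1 / n)` for all `A₁, …, Aₙ ∈ S`. All tuples are taken, so it does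
not matter in which order they are numbered. -/
def productRoots {N : ℕ} (f : Matrix (Fin N) (Fin N) ℝ → ℝ) (n : ℕ)
    (S : Set (Matrix (Fin N) (Fin N) ℝ)) : Set ℝ :=
  {x | ∃ A : Fin n → Matrix (Fin N) (Fin N) ℝ,
    (∀ i, A i ∈ S) ∧ x = f (List.ofFn A).prod ^ (1 / (n : ℝ))}

/-- `inf ρ(Aₙ ⋯ A₁) ^ (1 / n)` over `A₁, …, Aₙ ∈ S`. -/
def rhoCheckN {N : ℕ} (n : ℕ) (S : Set (Matrix (Fin N) (Fin N) ℝ)) : ℝ :=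
  sInf (productRoots rho n S)

/-- `sup ρ(Aₙ ⋯ A₁) ^ (1 / n)` over `A₁, …, Aₙ ∈ S`. -/
def rhoHatN {N : ℕ} (n : ℕ) (S : Set (Matrix (Fin N) (Fin N) ℝ)) : ℝ :=
  sSup (productRoots rho n S)

/-- The generalized spectral radius `sup_{n ≥ 1} sup ρ(Aₙ ⋯ A₁) ^ (1 / n)`. -/
def rhoHat {N : ℕ} (S : Set (Matrix (Fin N) (Fin N) ℝ)) : ℝ :=
  sSup ((fun n : ℕ => rhoHatN n S) '' Set.Ici 1)

/-- The matrix norm generated by a vector norm `ν`. -/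
def inducedNorm {N : ℕ} (ν : Seminorm ℝ (Fin N → ℝ)) (A : Matrix (Fin N) (Fin N) ℝ) : ℝ :=
  sInf {C : ℝ | 0 ≤ C ∧ ∀ x, ν (A.mulVec x) ≤ C * ν x}

/-- `inf ‖Aₙ ⋯ A₁‖ ^ (1 / n)` over `A₁, …, Aₙ ∈ S`. -/
def normCheckN {N : ℕ} (ν : Seminorm ℝ (Fin N → ℝ)) (n : ℕ)
    (S : Set (Matrix (Fin N) (Fin N) ℝ)) : ℝ :=
  sInf (productRoots (inducedNorm ν) n S)

/-- The lower spectral radius (joint spectral subradius)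
`inf_{n ≥ 1} inf ‖Aₙ ⋯ A₁‖ ^ (1 / n)`. -/
def rhoCheck {N : ℕ} (ν : Seminorm ℝ (Fin N → ℝ)) (S : Set (Matrix (Fin N) (Fin N) ℝ)) : ℝ :=
  sInf ((fun n : ℕ => normCheckN ν n S) '' Set.Ici 1)

end MatrixSets

end

open MatrixSets

/-! The property that matters is that for every `u ≥ 0` a single matrix of the set minimizes (or
maximizes) all coordinates of `A u` at once. Linearly ordered and compact IRU-sets have it, and
Minkowski sums, products and non-negative multiples preserve it for non-negative sets
(`isExtremalSet_minkowskiPolynomial`).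

Add `ε > 0` to all entries, let `A` minimize the perturbed spectral radius over `S`, and let `u > 0`
be its Perron vector. If the simultaneous minimizer at `u` improved any coordinate, its spectral
radius would be strictly smaller. So `u` is a common subeigenvector of all perturbed matrices
(`IsExtremalSet.exists_perturbed_min`; `IsExtremalSet.exists_perturbed_max` is the dual). Such
inequalities are linear in the matrix, hence extend to the convex hull, and they iterate along
products. Letting `ε → 0` bounds the spectral radius of a `k`-fold product by `rhoMin S ^ k` below
and `rhoMax S ^ k` above; powers of an extremal matrix attain both.

For the lower spectral radius, `rho ≤ inducedNorm` gives the lower bound and Gelfand's formula at a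
minimizing matrix gives the upper one. -/

noncomputable section

namespace MatrixSets

attribute [local instance] Matrix.linftyOpNormedRing Matrix.linftyOpNormedAlgebra

/-! ### Perron–Frobenius theory for the spectral radius -/

section Perron

variable {N M : ℕ}

/-- If `c rᵏ ≤ aₖ` with `c > 0`, then `r` is at most the limit of the roots of `aₖ`. -/
lemma le_of_tendsto_root {a : ℕ → ℝ} {l r c : ℝ} (hr : 0 ≤ r) (hc : 0 < c)
    (h : ∀ k, c * r ^ k ≤ a k) (ha : Tendsto (fun k : ℕ => a k ^ (1 / (k : ℝ))) atTop (𝓝 l)) :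
    r ≤ l := by
  have h1 : Tendsto (fun k : ℕ => c ^ (1 / (k : ℝ)) * r) atTop (𝓝 (c ^ (0 : ℝ) * r)) :=
    ((tendsto_const_nhds (x := c)).rpow tendsto_one_div_atTop_nhds_zero_nat
      (Or.inl hc.ne')).mul_const r
  rw [Real.rpow_zero, one_mul] at h1
  refine le_of_tendsto_of_tendsto h1 ha ?_
  filter_upwards [eventually_ge_atTop 1] with k hk
  have hk' : k ≠ 0 := by omega
  calc c ^ (1 / (k : ℝ)) * r = (c * r ^ k) ^ (1 / (k : ℝ)) := by
        rw [Real.mul_rpow hc.le (pow_nonneg hr k), one_div, Real.pow_rpow_inv_natCast hr hk']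
    _ ≤ a k ^ (1 / (k : ℝ)) :=
        Real.rpow_le_rpow (mul_nonneg hc.le (pow_nonneg hr k)) (h k) (by positivity)

lemma rho_nonneg (A : Matrix (Fin N) (Fin N) ℝ) : 0 ≤ rho A := ENNReal.toReal_nonneg

lemma norm_map_ofReal (A : Matrix (Fin N) (Fin N) ℝ) : ‖A.map Complex.ofReal‖ = ‖A‖ := by
  simp [Matrix.linfty_opNorm_def]

/-- Gelfand's formula for real matrices. -/
lemma tendsto_norm_pow_root (A : Matrix (Fin N) (Fin N) ℝ) :
    Tendsto (fun k : ℕ => ‖A ^ k‖ ^ (1 / (k : ℝ))) atTop (𝓝 (rho A)) := by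
  have h := spectrum.pow_norm_pow_one_div_tendsto_nhds_spectralRadius (A.map Complex.ofReal)
  have hfin : spectralRadius ℂ (A.map Complex.ofReal) ≠ ⊤ := by
    refine ne_top_of_le_ne_top ?_
      -- Index `0` stands for the first power: the bound is `‖A‖ * ‖1‖`.
      (spectrum.spectralRadius_le_pow_nnnorm_pow_one_div ℂ (A.map Complex.ofReal) 0)
    finiteness
  have h2 := (ENNReal.tendsto_toReal hfin).comp h
  refine h2.congr fun k => ?_
  have : (A.map Complex.ofReal) ^ k = (A ^ k).map Complex.ofReal :=
    (Matrix.map_pow A Complex.ofRealHom k).symm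
  simp only [Function.comp_apply]
  rw [ENNReal.toReal_ofReal (by positivity), this, norm_map_ofReal]

lemma mulVec_mono {A : Matrix (Fin N) (Fin M) ℝ} (hA : ∀ i j, 0 ≤ A i j) {x y : Fin M → ℝ}
    (h : x ≤ y) : A.mulVec x ≤ A.mulVec y := fun i => by
  simp only [Matrix.mulVec, dotProduct]
  exact Finset.sum_le_sum fun j _ => mul_le_mul_of_nonneg_left (h j) (hA i j)

lemma mulVec_nonneg {A : Matrix (Fin N) (Fin M) ℝ} (hA : ∀ i j, 0 ≤ A i j) {x : Fin M → ℝ}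
    (h : 0 ≤ x) : 0 ≤ A.mulVec x := fun i => by
  simp only [Matrix.mulVec, dotProduct, Pi.zero_apply]
  exact Finset.sum_nonneg fun j _ => mul_nonneg (hA i j) (h j)

lemma mulVec_le_mulVec {A B : Matrix (Fin N) (Fin M) ℝ} (h : ∀ i j, A i j ≤ B i j)
    {x : Fin M → ℝ} (hx : 0 ≤ x) : A.mulVec x ≤ B.mulVec x := fun i => by
  simp only [Matrix.mulVec, dotProduct]
  exact Finset.sum_le_sum fun j _ => mul_le_mul_of_nonneg_right (h i j) (hx j)

lemma mulVec_pos {A : Matrix (Fin N) (Fin M) ℝ} (hA : ∀ i j, 0 < A i j) {x : Fin M → ℝ}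
    (h : 0 ≤ x) (hx : x ≠ 0) (i : Fin N) : 0 < A.mulVec x i := by
  obtain ⟨j, hj⟩ := Function.ne_iff.1 hx
  exact Finset.sum_pos' (fun j _ => mul_nonneg (hA i j).le (h j))
    ⟨j, Finset.mem_univ _, mul_pos (hA i j) (lt_of_le_of_ne (h j) (Ne.symm hj))⟩

lemma exists_pos_of_nonneg {x : Fin N → ℝ} (h : 0 ≤ x) (hx : x ≠ 0) : ∃ i, 0 < x i := by
  obtain ⟨j, hj⟩ := Function.ne_iff.1 hx
  exact ⟨j, lt_of_le_of_ne (h j) (Ne.symm hj)⟩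

/-- Take coordinatewise moduli of a complex eigenvector for an eigenvalue of maximal modulus and
apply the triangle inequality. -/
lemma exists_rho_smul_le_mulVec [NeZero N] {A : Matrix (Fin N) (Fin N) ℝ}
    (hA : ∀ i j, 0 ≤ A i j) :
    ∃ x : Fin N → ℝ, 0 ≤ x ∧ x ≠ 0 ∧ rho A • x ≤ A.mulVec x := by
  obtain ⟨z, hz, hzr⟩ := spectrum.exists_nnnorm_eq_spectralRadius (A.map Complex.ofReal)
  have hρ : rho A = ‖z‖ := by rw [rho, ← hzr]; simp
  rw [← Matrix.spectrum_toLin', ← Module.End.hasEigenvalue_iff_mem_spectrum] at hz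
  obtain ⟨v, hv⟩ := hz.exists_hasEigenvector
  have hv1 : (A.map Complex.ofReal).mulVec v = z • v := by
    simpa using hv.apply_eq_smul
  refine ⟨fun i => ‖v i‖, fun i => norm_nonneg _, ?_, fun i => ?_⟩
  · intro h
    exact hv.2 (funext fun i => by simpa using congrFun h i)
  · have h1 := congrArg norm (congrFun hv1 i)
    rw [Pi.smul_apply, smul_eq_mul, norm_mul] at h1
    rw [Pi.smul_apply, smul_eq_mul, hρ, ← h1]
    simp only [Matrix.mulVec, dotProduct]
    refine (norm_sum_le _ _).trans (Finset.sum_le_sum fun j _ => ?_)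
    simp [abs_of_nonneg (hA i j)]

lemma prod_mulVec_ge {r : ℝ} (hr : 0 ≤ r) {x : Fin N → ℝ}
    (L : List (Matrix (Fin N) (Fin N) ℝ))
    (hL : ∀ A ∈ L, (∀ i j, 0 ≤ A i j) ∧ r • x ≤ A.mulVec x) :
    (∀ i j, 0 ≤ L.prod i j) ∧ r ^ L.length • x ≤ L.prod.mulVec x := by
  induction L with
  | nil => simp [Matrix.one_apply]; intro i j; split_ifs <;> norm_num
  | cons A L ih =>
    obtain ⟨h1, h2⟩ := ih fun B hB => hL B (List.mem_cons_of_mem _ hB)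
    obtain ⟨h3, h4⟩ := hL A List.mem_cons_self
    rw [List.prod_cons, List.length_cons, ← Matrix.mulVec_mulVec]
    refine ⟨fun i j => ?_, ?_⟩
    · rw [Matrix.mul_apply]
      exact Finset.sum_nonneg fun l _ => mul_nonneg (h3 i l) (h1 l j)
    refine le_trans ?_ (mulVec_mono h3 h2)
    rw [Matrix.mulVec_smul, pow_succ, mul_smul]
    exact smul_le_smul_of_nonneg_left h4 (pow_nonneg hr _)

lemma prod_mulVec_le {r : ℝ} (hr : 0 ≤ r) {x : Fin N → ℝ}
    (L : List (Matrix (Fin N) (Fin N) ℝ))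
    (hL : ∀ A ∈ L, (∀ i j, 0 ≤ A i j) ∧ A.mulVec x ≤ r • x) :
    L.prod.mulVec x ≤ r ^ L.length • x := by
  induction L with
  | nil => simp
  | cons A L ih =>
    have h2 := ih fun B hB => hL B (List.mem_cons_of_mem _ hB)
    obtain ⟨h3, h4⟩ := hL A List.mem_cons_self
    rw [List.prod_cons, List.length_cons, ← Matrix.mulVec_mulVec]
    refine le_trans (mulVec_mono h3 h2) ?_
    rw [Matrix.mulVec_smul, pow_succ, mul_smul]
    exact smul_le_smul_of_nonneg_left h4 (pow_nonneg hr _)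

lemma pow_mulVec_ge {r : ℝ} (hr : 0 ≤ r) {x : Fin N → ℝ} {A : Matrix (Fin N) (Fin N) ℝ}
    (hA : ∀ i j, 0 ≤ A i j) (h : r • x ≤ A.mulVec x) (k : ℕ) :
    r ^ k • x ≤ (A ^ k).mulVec x := by
  simpa using (prod_mulVec_ge hr (List.replicate k A) fun B hB => by
    rw [List.eq_of_mem_replicate hB]; exact ⟨hA, h⟩).2

/-- Iterating gives `r ^ k • x ≤ A ^ k x`, so `‖A ^ k‖` grows at least like `r ^ k`; Gelfand's
formula concludes. -/
lemma le_rho {A : Matrix (Fin N) (Fin N) ℝ} (hA : ∀ i j, 0 ≤ A i j) {r : ℝ} (hr : 0 ≤ r)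
    {x : Fin N → ℝ} (hx : 0 ≤ x) (hx0 : x ≠ 0) (h : r • x ≤ A.mulVec x) : r ≤ rho A := by
  obtain ⟨i, hi⟩ := exists_pos_of_nonneg hx hx0
  have hn : 0 < ‖x‖ := norm_pos_iff.2 hx0
  refine le_of_tendsto_root hr (div_pos hi hn) (fun k => ?_) (tendsto_norm_pow_root A)
  rw [div_mul_eq_mul_div, div_le_iff₀ hn, mul_comm]
  calc r ^ k * x i ≤ (A ^ k).mulVec x i := pow_mulVec_ge hr hA h k i
    _ ≤ ‖(A ^ k).mulVec x‖ := (le_abs_self _).trans (norm_le_pi_norm ((A ^ k).mulVec x) i)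
    _ ≤ ‖A ^ k‖ * ‖x‖ := Matrix.linfty_opNorm_mulVec _ _

/-- Scale `u` until it just dominates a subeigenvector `x` for `rho A`, and compare at a coordinate
where they touch. The scaling exists because `u` is strictly positive. -/
lemma rho_le_of_mulVec_le [NeZero N] {A : Matrix (Fin N) (Fin N) ℝ} (hA : ∀ i j, 0 ≤ A i j)
    {r : ℝ} {u : Fin N → ℝ} (hu : ∀ i, 0 < u i) (h : A.mulVec u ≤ r • u) : rho A ≤ r := by
  obtain ⟨x, hx, hx0, hxA⟩ := exists_rho_smul_le_mulVec hA
  obtain ⟨i, -, hi⟩ := Finset.exists_max_image Finset.univ (fun i => x i / u i)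
    Finset.univ_nonempty
  set t := x i / u i with ht
  have hxt : x ≤ t • u := fun j => (div_le_iff₀ (hu j)).1 (hi j (Finset.mem_univ j))
  have hxi : t * u i = x i := by rw [ht, div_mul_cancel₀ _ (hu i).ne']
  have ht0 : 0 ≤ t := div_nonneg (hx i) (hu i).le
  have htpos : 0 < x i := by
    rcases (hx i).lt_or_eq with h' | h'
    · exact h'
    · exfalso
      apply hx0
      have : t = 0 := by rw [ht, ← h']; simp
      refine le_antisymm (hxt.trans ?_) hx
      rw [this, zero_smul]
  have h1 : rho A * x i ≤ r * x i := by
    calc rho A * x i ≤ A.mulVec x i := hxA i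
      _ ≤ A.mulVec (t • u) i := mulVec_mono hA hxt i
      _ = t * A.mulVec u i := by rw [Matrix.mulVec_smul]; rfl
      _ ≤ t * (r * u i) := mul_le_mul_of_nonneg_left (h i) ht0
      _ = r * x i := by rw [← hxi]; ring
  exact le_of_mul_le_mul_right h1 htpos

lemma rho_mono [NeZero N] {A B : Matrix (Fin N) (Fin N) ℝ} (hA : ∀ i j, 0 ≤ A i j)
    (h : ∀ i j, A i j ≤ B i j) : rho A ≤ rho B := by
  obtain ⟨x, hx, hx0, hxA⟩ := exists_rho_smul_le_mulVec hA
  exact le_rho (fun i j => (hA i j).trans (h i j)) (rho_nonneg A) hx hx0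
    (hxA.trans (mulVec_le_mulVec h hx))

/-- A positive matrix sends the nonzero vector `A x - r x ≥ 0` to a strictly positive one. Hence `y
= A x` satisfies `r y < A y` in every coordinate, which leaves room for some `t > r`. -/
lemma lt_rho_of_pos [NeZero N] {A : Matrix (Fin N) (Fin N) ℝ} (hA : ∀ i j, 0 < A i j) {r : ℝ}
    (hr : 0 ≤ r) {x : Fin N → ℝ} (hx : 0 ≤ x) (h : r • x ≤ A.mulVec x)
    (hne : A.mulVec x ≠ r • x) : r < rho A := by
  have hA' : ∀ i j, 0 ≤ A i j := fun i j => (hA i j).le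
  have hx0 : x ≠ 0 := by rintro rfl; simp at hne
  have hy := mulVec_pos hA hx hx0
  have hd : ∀ i, 0 < A.mulVec (A.mulVec x - r • x) i :=
    mulVec_pos hA (sub_nonneg.2 h) (sub_ne_zero.2 hne)
  rw [Matrix.mulVec_sub, Matrix.mulVec_smul] at hd
  obtain ⟨i, -, hi⟩ := Finset.exists_min_image Finset.univ
    (fun i => A.mulVec (A.mulVec x) i / A.mulVec x i) Finset.univ_nonempty
  set t := A.mulVec (A.mulVec x) i / A.mulVec x i with ht
  have hrt : r < t := by
    rw [ht, lt_div_iff₀ (hy i)]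
    simpa using hd i
  refine hrt.trans_le (le_rho hA' (hr.trans hrt.le) (fun i => (hy i).le) ?_ fun j => ?_)
  · intro h0
    exact (hy i).ne' (congrFun h0 i)
  · exact (le_div_iff₀ (hy j)).1 (hi j (Finset.mem_univ j))

lemma rho_lt_of_pos [NeZero N] {A : Matrix (Fin N) (Fin N) ℝ} (hA : ∀ i j, 0 < A i j) {r : ℝ}
    {x : Fin N → ℝ} (hx : ∀ i, 0 < x i) (h : A.mulVec x ≤ r • x)
    (hne : A.mulVec x ≠ r • x) : rho A < r := by
  have hA' : ∀ i j, 0 ≤ A i j := fun i j => (hA i j).le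
  have hx0 : x ≠ 0 := fun h0 => (hx 0).ne' (congrFun h0 0)
  have hy := mulVec_pos hA (fun i => (hx i).le) hx0
  have hd : ∀ i, 0 < A.mulVec (r • x - A.mulVec x) i :=
    mulVec_pos hA (sub_nonneg.2 h) (sub_ne_zero.2 hne.symm)
  rw [Matrix.mulVec_sub, Matrix.mulVec_smul] at hd
  obtain ⟨i, -, hi⟩ := Finset.exists_max_image Finset.univ
    (fun i => A.mulVec (A.mulVec x) i / A.mulVec x i) Finset.univ_nonempty
  refine (rho_le_of_mulVec_le hA' hy fun j => ?_).trans_lt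
    (?_ : A.mulVec (A.mulVec x) i / A.mulVec x i < r)
  · exact (div_le_iff₀ (hy j)).1 (hi j (Finset.mem_univ j))
  · rw [div_lt_iff₀ (hy i)]
    simpa using hd i

/-- Perron's theorem. -/
lemma exists_pos_eigenvector [NeZero N] {A : Matrix (Fin N) (Fin N) ℝ} (hA : ∀ i j, 0 < A i j) :
    ∃ u : Fin N → ℝ, (∀ i, 0 < u i) ∧ A.mulVec u = rho A • u := by
  obtain ⟨x, hx, hx0, hxA⟩ := exists_rho_smul_le_mulVec fun i j => (hA i j).le
  have heq : A.mulVec x = rho A • x := by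
    by_contra hne
    exact lt_irrefl _ (lt_rho_of_pos hA (rho_nonneg A) hx hxA hne)
  refine ⟨x, fun i => lt_of_le_of_ne (hx i) fun h0 => ?_, heq⟩
  have h1 := mulVec_pos hA hx hx0 i
  rw [heq, Pi.smul_apply, ← h0] at h1
  simp at h1

/-- The spectral radius is continuous on the non-negative matrices. -/
lemma continuousOn_rho [NeZero N] :
    ContinuousOn (rho (N := N)) {A | ∀ i j, 0 ≤ A i j} := by
  intro A hA
  refine tendsto_order.2 ⟨fun a ha => ?_, fun b hb => ?_⟩
  · rcases lt_or_ge a 0 with h0 | h0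
    · exact Eventually.of_forall fun B => h0.trans_le (rho_nonneg B)
    -- Lower semicontinuity: the slack between `s` and `rho A` keeps `s • x ≤ B x` for `B` near `A`
    -- where `x i > 0`; where `x i = 0`, non-negativity of `B` suffices.
    obtain ⟨s, has, hs⟩ := exists_between ha
    obtain ⟨x, hx, hx0, hxA⟩ := exists_rho_smul_le_mulVec hA
    have h1 : ∀ i, ∀ᶠ B in 𝓝[{A | ∀ i j, 0 ≤ A i j}] A, s * x i ≤ B.mulVec x i := by
      intro i
      rcases (hx i).lt_or_eq with h | h
      · have h2 : s * x i < A.mulVec x i :=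
          (mul_lt_mul_of_pos_right hs h).trans_le (hxA i)
        have hc : Continuous fun B : Matrix (Fin N) (Fin N) ℝ => B.mulVec x i := by
          simp only [Matrix.mulVec, dotProduct]
          fun_prop
        filter_upwards [nhdsWithin_le_nhds (hc.continuousAt.eventually_const_lt h2)] with B hB
        exact hB.le
      · filter_upwards [self_mem_nhdsWithin] with B hB
        rw [← h]
        simpa using mulVec_nonneg hB hx i
    filter_upwards [eventually_all.2 h1, self_mem_nhdsWithin] with B hB hB0
    exact has.trans_le (le_rho hB0 (h0.trans has.le) hx hx0 hB)
  -- Upper semicontinuity: one fixed `k` gives an open condition on `B`, and `rho B` is at most the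
  -- `k`-th root of `‖B ^ k‖`.
  · obtain ⟨k, hk, hk1⟩ := (((tendsto_norm_pow_root A).eventually_lt_const hb).and
      (eventually_ge_atTop 1)).exists
    have hc : Continuous fun B : Matrix (Fin N) (Fin N) ℝ => ‖B ^ k‖ ^ (1 / (k : ℝ)) :=
      (continuous_pow k).norm.rpow_const fun _ => Or.inr (by positivity)
    filter_upwards [nhdsWithin_le_nhds (hc.continuousAt.eventually_lt_const hk),
      self_mem_nhdsWithin] with B hB hB0
    refine lt_of_le_of_lt ?_ hB
    obtain ⟨x, hx, hx0, hxB⟩ := exists_rho_smul_le_mulVec hB0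
    have hn : 0 < ‖x‖ := norm_pos_iff.2 hx0
    have hle : rho B ^ k ≤ ‖B ^ k‖ := by
      refine le_of_mul_le_mul_right ?_ hn
      rw [← Real.norm_of_nonneg (pow_nonneg (rho_nonneg B) k), ← norm_smul]
      refine (pi_norm_le_iff_of_nonneg (by positivity)).2 fun i => ?_
      rw [Real.norm_of_nonneg (smul_nonneg (pow_nonneg (rho_nonneg B) k) hx i)]
      exact (pow_mulVec_ge (rho_nonneg B) hB0 hxB k i).trans
        (((le_abs_self _).trans (norm_le_pi_norm ((B ^ k).mulVec x) i)).trans (Matrix.linfty_opNorm_mulVec _ _))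
    rw [← Real.pow_rpow_inv_natCast (rho_nonneg B) (show k ≠ 0 by omega), one_div]
    exact Real.rpow_le_rpow (pow_nonneg (rho_nonneg B) k) hle (by positivity)

end Perron

/-! ### Sets of matrices with simultaneous extrema -/

section Extrema

variable {N M K : ℕ}

/-- For every non-negative vector `u`, one matrix of `S` minimizes all the coordinates of
`s • A u` at once: with `s = 1` these are simultaneous minima of `A u`, with `s = -1`
simultaneous maxima. -/
def HasSimultaneousMin (s : ℝ) (S : Set (Matrix (Fin N) (Fin M) ℝ)) : Prop :=
  ∀ u : Fin M → ℝ, 0 ≤ u → ∃ A ∈ S, ∀ B ∈ S, s • A.mulVec u ≤ s • B.mulVec u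

lemma continuous_mulVec_const (u : Fin M → ℝ) :
    Continuous fun A : Matrix (Fin N) (Fin M) ℝ => A.mulVec u :=
  continuous_id.matrix_mulVec continuous_const

/-- Each coordinate of `A u` depends on one row only, so the rows can be optimized separately and
reassembled within `S`. -/
lemma IsIRU.hasSimultaneousMin {S : Set (Matrix (Fin N) (Fin M) ℝ)} (hS : IsIRU S)
    (hc : IsCompact S) (hne : S.Nonempty) (s : ℝ) : HasSimultaneousMin s S := by
  intro u _
  obtain ⟨R, rfl⟩ := hS
  have h : ∀ i, ∃ A ∈ {A : Matrix (Fin N) (Fin M) ℝ | ∀ i, A.row i ∈ R i},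
      IsMinOn (fun A : Matrix (Fin N) (Fin M) ℝ => s * A.mulVec u i) {A | ∀ i, A.row i ∈ R i} A :=
    fun i => hc.exists_isMinOn hne
      (((continuous_apply i).comp (continuous_mulVec_const u)).const_mul s |>.continuousOn)
  choose A hA hmin using h
  refine ⟨Matrix.of fun i => (A i).row i, fun i => hA i i, fun B hB i => ?_⟩
  exact isMinOn_iff.1 (hmin i) B hB

/-- For `u ≥ 0` the vectors `s • A u` again form a chain, reversed if `s < 0`, so a minimal one is
least. -/
lemma IsFiniteLinearlyOrdered.hasSimultaneousMin {S : Set (Matrix (Fin N) (Fin M) ℝ)}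
    (hS : IsFiniteLinearlyOrdered S) (hne : S.Nonempty) (s : ℝ) : HasSimultaneousMin s S := by
  intro u hu
  obtain ⟨A, hA, hmin⟩ := hS.1.exists_minimalFor (fun A => s • A.mulVec u) S hne
  refine ⟨A, hA, fun B hB => ?_⟩
  have hcomp : ∀ C D : Matrix (Fin N) (Fin M) ℝ, (∀ i j, C i j ≤ D i j) →
      s • C.mulVec u ≤ s • D.mulVec u ∨ s • D.mulVec u ≤ s • C.mulVec u := by
    intro C D h
    have h1 := mulVec_le_mulVec h hu
    rcases le_total 0 s with h0 | h0
    · exact Or.inl (smul_le_smul_of_nonneg_left h1 h0)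
    · exact Or.inr (smul_le_smul_of_nonpos_left h1 h0)
  have hor : s • A.mulVec u ≤ s • B.mulVec u ∨ s • B.mulVec u ≤ s • A.mulVec u := by
    rcases eq_or_ne A B with rfl | hAB
    · exact Or.inl le_rfl
    · rcases hS.2 hA hB hAB with h | h
      · exact hcomp A B h
      · exact (hcomp B A h).symm
  exact hor.elim id fun h => hmin hB h

lemma HasSimultaneousMin.add {s : ℝ} {S T : Set (Matrix (Fin N) (Fin M) ℝ)}
    (hS : HasSimultaneousMin s S) (hT : HasSimultaneousMin s T) :
    HasSimultaneousMin s (S + T) := by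
  intro u hu
  obtain ⟨A, hA, hA'⟩ := hS u hu
  obtain ⟨B, hB, hB'⟩ := hT u hu
  refine ⟨A + B, Set.add_mem_add hA hB, ?_⟩
  rintro _ ⟨C, hC, D, hD, rfl⟩
  simp only [Matrix.add_mulVec, smul_add]
  exact add_le_add (hA' C hC) (hB' D hD)

lemma HasSimultaneousMin.smul {s : ℝ} {S : Set (Matrix (Fin N) (Fin M) ℝ)}
    (hS : HasSimultaneousMin s S) {a : ℝ} (ha : 0 ≤ a) : HasSimultaneousMin s (a • S) := by
  intro u hu
  obtain ⟨A, hA, hA'⟩ := hS u hu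
  refine ⟨a • A, Set.smul_mem_smul_set hA, ?_⟩
  rintro _ ⟨C, hC, rfl⟩
  simp only [Matrix.smul_mulVec, smul_comm s a]
  exact smul_le_smul_of_nonneg_left (hA' C hC) ha

/-- Optimize the right factor at `u`, then the left factor at the resulting vector `B u ≥ 0`.
Non-negative left factors preserve the first inequality. -/
lemma HasSimultaneousMin.mul {s : ℝ} {S : Set (Matrix (Fin N) (Fin M) ℝ)}
    {T : Set (Matrix (Fin M) (Fin K) ℝ)} (hS : HasSimultaneousMin s S)
    (hT : HasSimultaneousMin s T) (hS0 : IsNonnegSet S) (hT0 : IsNonnegSet T) :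
    HasSimultaneousMin s (Set.image2 (fun A B => A * B) S T) := by
  intro u hu
  obtain ⟨B, hB, hB'⟩ := hT u hu
  obtain ⟨A, hA, hA'⟩ := hS _ (mulVec_nonneg (hT0 B hB) hu)
  refine ⟨A * B, Set.mem_image2_of_mem hA hB, ?_⟩
  rintro _ ⟨C, hC, D, hD, rfl⟩
  simp only [← Matrix.mulVec_mulVec]
  refine (hA' C hC).trans ?_
  rw [← Matrix.mulVec_smul C, ← Matrix.mulVec_smul C]
  exact mulVec_mono (hS0 C hC) (hB' D hD)

/-- The class of sets over which spectral characteristics are finite: non-empty compact sets of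
non-negative matrices with simultaneous minima and maxima. -/
structure IsExtremalSet (S : Set (Matrix (Fin N) (Fin M) ℝ)) : Prop where
  nonempty : S.Nonempty
  isCompact : IsCompact S
  nonneg : IsNonnegSet S
  hasSimultaneousMin : ∀ s : ℝ, HasSimultaneousMin s S

lemma IsExtremalSet.add {S T : Set (Matrix (Fin N) (Fin M) ℝ)} (hS : IsExtremalSet S)
    (hT : IsExtremalSet T) : IsExtremalSet (S + T) where
  nonempty := hS.nonempty.add hT.nonempty
  isCompact := hS.isCompact.add hT.isCompact
  nonneg := by
    rintro _ ⟨A, hA, B, hB, rfl⟩ i j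
    exact add_nonneg (hS.nonneg A hA i j) (hT.nonneg B hB i j)
  hasSimultaneousMin s := (hS.hasSimultaneousMin s).add (hT.hasSimultaneousMin s)

lemma IsExtremalSet.smul {S : Set (Matrix (Fin N) (Fin M) ℝ)} (hS : IsExtremalSet S)
    {a : ℝ} (ha : 0 ≤ a) : IsExtremalSet (a • S) where
  nonempty := hS.nonempty.smul_set
  isCompact := hS.isCompact.smul a
  nonneg := by
    rintro _ ⟨A, hA, rfl⟩ i j
    exact mul_nonneg ha (hS.nonneg A hA i j)
  hasSimultaneousMin s := (hS.hasSimultaneousMin s).smul ha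

lemma IsExtremalSet.mul {S : Set (Matrix (Fin N) (Fin M) ℝ)}
    {T : Set (Matrix (Fin M) (Fin K) ℝ)} (hS : IsExtremalSet S) (hT : IsExtremalSet T) :
    IsExtremalSet (Set.image2 (fun A B => A * B) S T) where
  nonempty := hS.nonempty.image2 hT.nonempty
  isCompact := by
    rw [← Set.image_prod]
    exact (hS.isCompact.prod hT.isCompact).image (continuous_fst.matrix_mul continuous_snd)
  nonneg := by
    rintro _ ⟨A, hA, B, hB, rfl⟩ i j
    simp only [Matrix.mul_apply]
    exact Finset.sum_nonneg fun l _ => mul_nonneg (hS.nonneg A hA i l) (hT.nonneg B hB l j)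
  hasSimultaneousMin s :=
    (hS.hasSimultaneousMin s).mul (hT.hasSimultaneousMin s) hS.nonneg hT.nonneg

lemma isExtremalSet_singleton_zero :
    IsExtremalSet ({0} : Set (Matrix (Fin N) (Fin M) ℝ)) where
  nonempty := Set.singleton_nonempty _
  isCompact := isCompact_singleton
  nonneg := by simp [IsNonnegSet]
  hasSimultaneousMin s u _ := ⟨0, rfl, by simp⟩

lemma AdmissibleWord.isExtremalSet_eval {n : ℕ} {r c : Fin n → ℕ}
    {𝒜 : (i : Fin n) → Set (Matrix (Fin (r i)) (Fin (c i)) ℝ)}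
    (h : ∀ i, IsExtremalSet (𝒜 i)) {N M : ℕ} (w : AdmissibleWord r c N M) :
    IsExtremalSet (w.eval 𝒜) := by
  induction w with
  | single i => exact h i
  | cons i w ih => exact (h i).mul ih

lemma isExtremalSet_minkowskiPolynomial {n : ℕ} {r c : Fin n → ℕ}
    {𝒜 : (i : Fin n) → Set (Matrix (Fin (r i)) (Fin (c i)) ℝ)}
    (h : ∀ i, IsExtremalSet (𝒜 i)) (W : Finset (AdmissibleWord r c N M))
    {p : AdmissibleWord r c N M → ℝ} (hp : ∀ w ∈ W, 0 < p w) :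
    IsExtremalSet (minkowskiPolynomial W p 𝒜) :=
  Finset.sum_induction _ IsExtremalSet (fun _ _ => IsExtremalSet.add)
    isExtremalSet_singleton_zero fun w hw => (w.isExtremalSet_eval h).smul (hp w hw).le

end Extrema

/-! ### Spectral bounds for products of matrices from the convex hull -/

section Bounds

variable {N : ℕ}

lemma IsNonnegSet.convexHull {S : Set (Matrix (Fin N) (Fin N) ℝ)} (hS : IsNonnegSet S) :
    IsNonnegSet (convexHull ℝ S) := by
  have : Convex ℝ {A : Matrix (Fin N) (Fin N) ℝ | ∀ i j, 0 ≤ A i j} := by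
    intro A hA B hB a b ha hb _ i j
    exact add_nonneg (mul_nonneg ha (hA i j)) (mul_nonneg hb (hB i j))
  exact fun A hA => convexHull_min hS this hA

lemma isLinearMap_mulVec_const (u : Fin N → ℝ) :
    IsLinearMap ℝ fun A : Matrix (Fin N) (Fin N) ℝ => A.mulVec u :=
  ⟨fun A B => Matrix.add_mulVec A B u, fun a A => Matrix.smul_mulVec a A u⟩

lemma le_mulVec_of_mem_convexHull {S : Set (Matrix (Fin N) (Fin N) ℝ)} {u v : Fin N → ℝ}
    (h : ∀ B ∈ S, v ≤ B.mulVec u) {B : Matrix (Fin N) (Fin N) ℝ} (hB : B ∈ convexHull ℝ S) :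
    v ≤ B.mulVec u :=
  convexHull_min h ((convex_Ici (𝕜 := ℝ) v).is_linear_preimage (isLinearMap_mulVec_const u)) hB

lemma mulVec_le_of_mem_convexHull {S : Set (Matrix (Fin N) (Fin N) ℝ)} {u v : Fin N → ℝ}
    (h : ∀ B ∈ S, B.mulVec u ≤ v) {B : Matrix (Fin N) (Fin N) ℝ} (hB : B ∈ convexHull ℝ S) :
    B.mulVec u ≤ v :=
  convexHull_min h ((convex_Iic (𝕜 := ℝ) v).is_linear_preimage (isLinearMap_mulVec_const u)) hB

/-- The matrix all of whose entries are `ε`. -/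
abbrev constMatrix (N : ℕ) (ε : ℝ) : Matrix (Fin N) (Fin N) ℝ := Matrix.of fun _ _ => ε

lemma continuous_constMatrix : Continuous (constMatrix N) :=
  continuous_matrix fun _ _ => continuous_id

lemma isExtremalSet_singleton {A : Matrix (Fin N) (Fin N) ℝ} (hA : ∀ i j, 0 ≤ A i j) :
    IsExtremalSet {A} where
  nonempty := Set.singleton_nonempty _
  isCompact := isCompact_singleton
  nonneg := by rintro _ rfl; exact hA
  hasSimultaneousMin s u _ := ⟨A, rfl, by rintro _ rfl; exact le_rfl⟩

variable [NeZero N] {S : Set (Matrix (Fin N) (Fin N) ℝ)}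

lemma IsExtremalSet.continuousOn_rho_add (hS : IsExtremalSet S) {ε : ℝ} (hε : 0 < ε) :
    ContinuousOn (fun A => rho (A + constMatrix N ε)) S :=
  continuousOn_rho.comp (continuous_id.add continuous_const).continuousOn
    fun A hA i j => add_nonneg (hS.nonneg A hA i j) hε.le

/-- The perturbation makes Perron's theorem and the strict comparison `rho_lt_of_pos` available. -/
lemma IsExtremalSet.exists_perturbed_min (hS : IsExtremalSet S) {ε : ℝ} (hε : 0 < ε) :
    ∃ A ∈ S, ∃ u : Fin N → ℝ, (∀ i, 0 < u i) ∧
      ∀ B ∈ S, rho (A + constMatrix N ε) • u ≤ (B + constMatrix N ε).mulVec u := by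
  obtain ⟨A, hA, hmin⟩ := hS.isCompact.exists_isMinOn hS.nonempty (hS.continuousOn_rho_add hε)
  have hpos : ∀ B ∈ S, ∀ i j, 0 < (B + constMatrix N ε) i j := fun B hB i j =>
    add_pos_of_nonneg_of_pos (hS.nonneg B hB i j) hε
  obtain ⟨u, hu, hAu⟩ := exists_pos_eigenvector (hpos A hA)
  refine ⟨A, hA, u, hu, fun B hB => ?_⟩
  obtain ⟨C, hC, hCmin⟩ := hS.hasSimultaneousMin 1 u fun i => (hu i).le
  simp only [one_smul] at hCmin
  have hle : ∀ B ∈ S, (C + constMatrix N ε).mulVec u ≤ (B + constMatrix N ε).mulVec u :=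
    fun B hB => by
      rw [Matrix.add_mulVec, Matrix.add_mulVec]
      exact add_le_add (hCmin B hB) le_rfl
  -- Otherwise `C` would beat the minimizer `A`.
  have heq : (C + constMatrix N ε).mulVec u = rho (A + constMatrix N ε) • u := by
    by_contra hne
    exact (isMinOn_iff.1 hmin C hC).not_gt
      (rho_lt_of_pos (hpos C hC) hu ((hle A hA).trans hAu.le) hne)
  exact heq.symm.le.trans (hle B hB)

lemma IsExtremalSet.exists_perturbed_max (hS : IsExtremalSet S) {ε : ℝ} (hε : 0 < ε) :
    ∃ A ∈ S, ∃ u : Fin N → ℝ, (∀ i, 0 < u i) ∧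
      ∀ B ∈ S, (B + constMatrix N ε).mulVec u ≤ rho (A + constMatrix N ε) • u := by
  obtain ⟨A, hA, hmax⟩ := hS.isCompact.exists_isMaxOn hS.nonempty (hS.continuousOn_rho_add hε)
  have hpos : ∀ B ∈ S, ∀ i j, 0 < (B + constMatrix N ε) i j := fun B hB i j =>
    add_pos_of_nonneg_of_pos (hS.nonneg B hB i j) hε
  obtain ⟨u, hu, hAu⟩ := exists_pos_eigenvector (hpos A hA)
  refine ⟨A, hA, u, hu, fun B hB => ?_⟩
  obtain ⟨C, hC, hCmax⟩ := hS.hasSimultaneousMin (-1) u fun i => (hu i).le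
  simp only [neg_smul, one_smul, neg_le_neg_iff] at hCmax
  have hle : ∀ B ∈ S, (B + constMatrix N ε).mulVec u ≤ (C + constMatrix N ε).mulVec u :=
    fun B hB => by
      rw [Matrix.add_mulVec, Matrix.add_mulVec]
      exact add_le_add (hCmax B hB) le_rfl
  have heq : (C + constMatrix N ε).mulVec u = rho (A + constMatrix N ε) • u := by
    by_contra hne
    exact (isMaxOn_iff.1 hmax C hC).not_gt
      (lt_rho_of_pos (hpos C hC) (rho_nonneg _) (fun i => (hu i).le)
        (hAu.symm.le.trans (hle A hA)) hne)
  exact (hle B hB).trans heq.le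

/-- A common subeigenvector for the matrices of an extremal set. -/
lemma IsExtremalSet.exists_smul_le_mulVec (hS : IsExtremalSet S) {m : ℝ}
    (hm : ∀ A ∈ S, m ≤ rho A) :
    ∃ u : Fin N → ℝ, 0 ≤ u ∧ u ≠ 0 ∧ ∀ B ∈ S, m • u ≤ B.mulVec u := by
  -- Normalizing to the simplex gives compactness and keeps the limit vector nonzero.
  have h : ∀ k : ℕ, ∃ u ∈ stdSimplex ℝ (Fin N), ∀ B ∈ S,
      m • u ≤ (B + constMatrix N (1 / ((k : ℝ) + 1))).mulVec u := by
    intro k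
    have hε : 0 < 1 / ((k : ℝ) + 1) := by positivity
    obtain ⟨A, hA, u, hu, hB⟩ := hS.exists_perturbed_min hε
    have hsum : 0 < ∑ i, u i := Finset.sum_pos (fun i _ => hu i) Finset.univ_nonempty
    refine ⟨(∑ i, u i)⁻¹ • u, ⟨fun i => (mul_pos (inv_pos.2 hsum) (hu i)).le, ?_⟩,
      fun B hBS => ?_⟩
    · simp only [Pi.smul_apply, smul_eq_mul]
      rw [← Finset.mul_sum, inv_mul_cancel₀ hsum.ne']
    · rw [Matrix.mulVec_smul, smul_comm]
      refine smul_le_smul_of_nonneg_left (le_trans ?_ (hB B hBS)) (inv_pos.2 hsum).le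
      refine smul_le_smul_of_nonneg_right ((hm A hA).trans ?_) fun i => (hu i).le
      exact rho_mono (hS.nonneg A hA) fun i j => le_add_of_nonneg_right hε.le
  choose u hu hle using h
  obtain ⟨v, hv, φ, hφ, hlim⟩ := (isCompact_stdSimplex ℝ (Fin N)).tendsto_subseq hu
  refine ⟨v, hv.1, ?_, fun B hB => ?_⟩
  · rintro rfl
    simpa using hv.2
  · have hε : Tendsto (fun k => constMatrix N (1 / ((φ k : ℝ) + 1))) atTop
        (𝓝 (constMatrix N 0)) :=
      (continuous_constMatrix.tendsto 0).comp
        (tendsto_one_div_add_atTop_nhds_zero_nat.comp hφ.tendsto_atTop)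
    have hc : Continuous fun q : Matrix (Fin N) (Fin N) ℝ × (Fin N → ℝ) => (B + q.1).mulVec q.2 :=
      (continuous_const.add continuous_fst).matrix_mulVec continuous_snd
    have h2 := (hc.tendsto (constMatrix N 0, v)).comp (hε.prodMk_nhds hlim)
    have h0 : B + constMatrix N 0 = B := by ext; simp
    simp only [h0] at h2
    exact le_of_tendsto_of_tendsto' (hlim.const_smul m) h2 fun k => hle (φ k) B hB

lemma IsExtremalSet.pow_le_rho_prod (hS : IsExtremalSet S) {m : ℝ} (hm0 : 0 ≤ m)
    (hm : ∀ A ∈ S, m ≤ rho A) {L : List (Matrix (Fin N) (Fin N) ℝ)}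
    (hL : ∀ A ∈ L, A ∈ convexHull ℝ S) : m ^ L.length ≤ rho L.prod := by
  obtain ⟨u, hu, hu0, hB⟩ := hS.exists_smul_le_mulVec hm
  obtain ⟨h1, h2⟩ := prod_mulVec_ge hm0 L fun A hA =>
    ⟨hS.nonneg.convexHull A (hL A hA), le_mulVec_of_mem_convexHull hB (hL A hA)⟩
  exact le_rho h1 (pow_nonneg hm0 _) hu hu0 h2

/-- A limit of the vectors `u` could lose positivity, which the upper bound needs. So the product is
bounded for each `ε` first, and the limit is taken in the spectral radii, using compactness of `S`
and continuity of `rho`. -/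
lemma IsExtremalSet.rho_prod_le_pow (hS : IsExtremalSet S) {m : ℝ}
    (hm : ∀ A ∈ S, rho A ≤ m) {L : List (Matrix (Fin N) (Fin N) ℝ)}
    (hL : ∀ A ∈ L, A ∈ convexHull ℝ S) : rho L.prod ≤ m ^ L.length := by
  have hL0 : ∀ A ∈ L, ∀ i j, 0 ≤ A i j := fun A hA => hS.nonneg.convexHull A (hL A hA)
  have h : ∀ k : ℕ, ∃ A ∈ S,
      rho L.prod ≤ rho (A + constMatrix N (1 / ((k : ℝ) + 1))) ^ L.length := by
    intro k
    have hε : 0 < 1 / ((k : ℝ) + 1) := by positivity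
    obtain ⟨A, hA, u, hu, hB⟩ := hS.exists_perturbed_max hε
    refine ⟨A, hA, rho_le_of_mulVec_le
      -- With `r = 0`, `x = 0` only the non-negativity of the product is extracted.
      (prod_mulVec_ge (r := 0) (x := 0) le_rfl L fun A hA => ⟨hL0 A hA, by simp⟩).1 hu
      (prod_mulVec_le (rho_nonneg _) L fun B hBL =>
        ⟨hL0 B hBL, mulVec_le_of_mem_convexHull (fun C hC => ?_) (hL B hBL)⟩)⟩
    exact (mulVec_le_mulVec (fun i j => le_add_of_nonneg_right hε.le) fun i => (hu i).le).trans
      (hB C hC)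
  choose A hA hle using h
  have : FirstCountableTopology (Matrix (Fin N) (Fin N) ℝ) :=
    inferInstanceAs (FirstCountableTopology (Fin N → Fin N → ℝ))
  obtain ⟨B, hB, φ, hφ, hlim⟩ := hS.isCompact.tendsto_subseq hA
  have hε : Tendsto (fun k => constMatrix N (1 / ((φ k : ℝ) + 1))) atTop (𝓝 (constMatrix N 0)) :=
    (continuous_constMatrix.tendsto 0).comp
      (tendsto_one_div_add_atTop_nhds_zero_nat.comp hφ.tendsto_atTop)
  have h0 : B + constMatrix N 0 = B := by ext; simp
  have h1 := hlim.add hε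
  rw [h0] at h1
  have h2 := (continuousOn_rho B (hS.nonneg B hB)).tendsto.comp
    (tendsto_nhdsWithin_iff.2 ⟨h1, Eventually.of_forall fun k i j =>
      add_nonneg (hS.nonneg _ (hA (φ k)) i j) (by positivity : 0 ≤ 1 / ((φ k : ℝ) + 1))⟩)
  exact (ge_of_tendsto' (h2.pow L.length) fun k => hle (φ k)).trans
    (pow_le_pow_left₀ (rho_nonneg B) (hm B hB) _)

lemma rho_pow {A : Matrix (Fin N) (Fin N) ℝ} (hA : ∀ i j, 0 ≤ A i j) (k : ℕ) :
    rho (A ^ k) = rho A ^ k := by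
  have hL : ∀ B ∈ List.replicate k A, B ∈ convexHull ℝ {A} := fun B hB => by
    rw [List.eq_of_mem_replicate hB]; simp
  have h1 := (isExtremalSet_singleton hA).pow_le_rho_prod (rho_nonneg A) (by simp) hL
  have h2 := (isExtremalSet_singleton hA).rho_prod_le_pow (m := rho A) (by simp) hL
  rw [List.length_replicate, List.prod_replicate] at h1 h2
  exact le_antisymm h2 h1

end Bounds

/-! ### The norm induced by a vector norm -/

section InducedNorm

variable {N : ℕ}

/-- Equivalence of norms in finite dimension: `ν` is convex, hence continuous, and has a positive
minimum on the unit sphere, unless the sphere is empty. -/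
lemma exists_seminorm_bounds (ν : Seminorm ℝ (Fin N → ℝ)) (hν : ∀ x, ν x = 0 → x = 0) :
    ∃ c K : ℝ, 0 < c ∧ 0 < K ∧ ∀ x, c * ‖x‖ ≤ ν x ∧ ν x ≤ K * ‖x‖ := by
  have hcont : Continuous ν := by
    rw [← continuousOn_univ]
    exact ν.convexOn.continuousOn isOpen_univ
  have hb := Seminorm.bound_of_continuous_normedSpace ν hcont
  obtain ⟨K, hK, hK'⟩ := hb
  rcases (Metric.sphere (0 : Fin N → ℝ) 1).eq_empty_or_nonempty with he | hne
  · refine ⟨1, K, one_pos, hK, fun x => ⟨?_, hK' x⟩⟩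
    have : x = 0 := by
      by_contra hx
      have : ‖x‖⁻¹ • x ∈ Metric.sphere (0 : Fin N → ℝ) 1 := by
        simp [norm_smul, norm_ne_zero_iff.2 hx]
      simp [he] at this
    simp [this]
  · obtain ⟨y, hy, hmin⟩ := (isCompact_sphere (0 : Fin N → ℝ) 1).exists_isMinOn hne
      hcont.continuousOn
    have hy0 : y ≠ 0 := by
      rintro rfl
      simp at hy
    refine ⟨ν y, K, lt_of_le_of_ne (apply_nonneg ν y) fun h => hy0 (hν y h.symm), hK,
      fun x => ⟨?_, hK' x⟩⟩
    rcases eq_or_ne x 0 with rfl | hx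
    · simp
    have hxn : 0 < ‖x‖ := norm_pos_iff.2 hx
    have h := isMinOn_iff.1 hmin (‖x‖⁻¹ • x) (by simp [norm_smul, hxn.ne'])
    rw [map_smul_eq_mul, norm_inv, norm_norm, inv_mul_eq_div, le_div_iff₀ hxn] at h
    exact h

lemma inducedNorm_nonneg (ν : Seminorm ℝ (Fin N → ℝ)) (A : Matrix (Fin N) (Fin N) ℝ) :
    0 ≤ inducedNorm ν A := Real.sInf_nonneg fun _ h => h.1

lemma mulVec_bound_of_seminorm_bounds {ν : Seminorm ℝ (Fin N → ℝ)} {c K : ℝ} (hc : 0 < c)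
    (hK : 0 < K) (h : ∀ x, c * ‖x‖ ≤ ν x ∧ ν x ≤ K * ‖x‖) (A : Matrix (Fin N) (Fin N) ℝ) :
    K / c * ‖A‖ ∈ {C : ℝ | 0 ≤ C ∧ ∀ x, ν (A.mulVec x) ≤ C * ν x} := by
  refine ⟨by positivity, fun x => ?_⟩
  calc ν (A.mulVec x) ≤ K * ‖A.mulVec x‖ := (h _).2
    _ ≤ K * (‖A‖ * ‖x‖) := by gcongr; exact Matrix.linfty_opNorm_mulVec A x
    _ = K / c * ‖A‖ * (c * ‖x‖) := by field_simp
    _ ≤ K / c * ‖A‖ * ν x := by gcongr; exact (h x).1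

lemma exists_inducedNorm_le (ν : Seminorm ℝ (Fin N → ℝ)) (hν : ∀ x, ν x = 0 → x = 0) :
    ∃ b : ℝ, 0 < b ∧ ∀ A : Matrix (Fin N) (Fin N) ℝ, inducedNorm ν A ≤ b * ‖A‖ := by
  obtain ⟨c, K, hc, hK, h⟩ := exists_seminorm_bounds ν hν
  exact ⟨K / c, by positivity, fun A =>
    csInf_le ⟨0, fun _ h => h.1⟩ (mulVec_bound_of_seminorm_bounds hc hK h A)⟩

/-- On a subeigenvector `x`, `ν (A ^ k x)` grows at least like `rho A ^ k` and at most like `C ^ k`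
for any admissible constant `C`. -/
lemma rho_le_inducedNorm [NeZero N] (ν : Seminorm ℝ (Fin N → ℝ)) (hν : ∀ x, ν x = 0 → x = 0)
    {A : Matrix (Fin N) (Fin N) ℝ} (hA : ∀ i j, 0 ≤ A i j) : rho A ≤ inducedNorm ν A := by
  obtain ⟨c, K, hc, hK, h⟩ := exists_seminorm_bounds ν hν
  refine le_csInf ⟨_, mulVec_bound_of_seminorm_bounds hc hK h A⟩ ?_
  rintro C ⟨hC, hCA⟩
  obtain ⟨x, hx, hx0, hxA⟩ := exists_rho_smul_le_mulVec hA
  obtain ⟨i, hi⟩ := exists_pos_of_nonneg hx hx0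
  have hνx : 0 < ν x := lt_of_lt_of_le (mul_pos hc (norm_pos_iff.2 hx0)) (h x).1
  have hpow : ∀ k : ℕ, ν ((A ^ k).mulVec x) ≤ C ^ k * ν x := by
    intro k
    induction k with
    | zero => simp
    | succ k ih =>
      rw [pow_succ', ← Matrix.mulVec_mulVec, pow_succ', mul_assoc]
      exact (hCA _).trans (mul_le_mul_of_nonneg_left ih hC)
  refine le_of_tendsto_root (a := fun k => C ^ k) (c := c * x i / ν x) (rho_nonneg A)
    (by positivity) (fun k => ?_) ?_
  · rw [div_mul_eq_mul_div, div_le_iff₀ hνx]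
    calc c * x i * rho A ^ k = c * (rho A ^ k * x i) := by ring
      _ ≤ c * ‖(A ^ k).mulVec x‖ := by
        gcongr
        exact (pow_mulVec_ge (rho_nonneg A) hA hxA k i).trans
          ((le_abs_self _).trans (norm_le_pi_norm ((A ^ k).mulVec x) i))
      _ ≤ ν ((A ^ k).mulVec x) := (h _).1
      _ ≤ C ^ k * ν x := hpow k
  · refine tendsto_const_nhds.congr' ?_
    filter_upwards [eventually_ge_atTop 1] with k hk
    rw [one_div, Real.pow_rpow_inv_natCast hC (by omega)]

end InducedNorm

/-! ### Spectral characteristics of sets of matrices -/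

section Characteristics

variable {N : ℕ}

lemma AdmissibleWord.pos {n : ℕ} {r c : Fin n → ℕ} (hr : ∀ i, 0 < r i) {N M : ℕ}
    (w : AdmissibleWord r c N M) : 0 < N := by
  cases w <;> exact hr _

lemma productRoots_one (f : Matrix (Fin N) (Fin N) ℝ → ℝ) (T : Set (Matrix (Fin N) (Fin N) ℝ)) :
    productRoots f 1 T = f '' T := by
  ext x
  constructor
  · rintro ⟨A, hA, rfl⟩
    exact ⟨A 0, hA 0, by simp⟩
  · rintro ⟨A, hA, rfl⟩
    exact ⟨fun _ => A, fun _ => hA, by simp⟩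

variable [NeZero N] {S T : Set (Matrix (Fin N) (Fin N) ℝ)}

lemma isLeast_rhoMin (hT : IsCompact T) (hne : T.Nonempty) (h0 : IsNonnegSet T) :
    IsLeast (rho '' T) (rhoMin T) :=
  (hT.image_of_continuousOn (continuousOn_rho.mono h0)).isLeast_sInf (hne.image _)

lemma isGreatest_rhoMax (hT : IsCompact T) (hne : T.Nonempty) (h0 : IsNonnegSet T) :
    IsGreatest (rho '' T) (rhoMax T) :=
  (hT.image_of_continuousOn (continuousOn_rho.mono h0)).isGreatest_sSup (hne.image _)

lemma mem_productRoots_rho {A : Matrix (Fin N) (Fin N) ℝ} (hA : ∀ i j, 0 ≤ A i j)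
    (hAT : A ∈ T) {k : ℕ} (hk : 1 ≤ k) : rho A ∈ productRoots rho k T := by
  refine ⟨fun _ => A, fun _ => hAT, ?_⟩
  rw [List.ofFn_const, List.prod_replicate, rho_pow hA, one_div,
    Real.pow_rpow_inv_natCast (rho_nonneg A) (by omega)]

lemma IsExtremalSet.isLeast_productRoots (hS : IsExtremalSet S) (hST : S ⊆ T)
    (hTS : T ⊆ convexHull ℝ S) {k : ℕ} (hk : 1 ≤ k) :
    IsLeast (productRoots rho k T) (rhoMin S) := by
  obtain ⟨⟨A, hA, hAm⟩, hlow⟩ := isLeast_rhoMin hS.isCompact hS.nonempty hS.nonneg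
  constructor
  · rw [← hAm]
    exact mem_productRoots_rho (hS.nonneg A hA) (hST hA) hk
  · rintro _ ⟨B, hB, rfl⟩
    have hm0 : 0 ≤ rhoMin S := hAm ▸ rho_nonneg A
    have h := hS.pow_le_rho_prod hm0 (fun A hA => hlow ⟨A, hA, rfl⟩) (L := List.ofFn B)
      fun C hC => by
        obtain ⟨i, rfl⟩ := List.mem_ofFn.1 hC
        exact hTS (hB i)
    rw [List.length_ofFn] at h
    rw [← Real.pow_rpow_inv_natCast hm0 (show k ≠ 0 by omega), ← one_div]
    exact Real.rpow_le_rpow (pow_nonneg hm0 k) h (by positivity)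

lemma IsExtremalSet.isGreatest_productRoots (hS : IsExtremalSet S) (hST : S ⊆ T)
    (hTS : T ⊆ convexHull ℝ S) {k : ℕ} (hk : 1 ≤ k) :
    IsGreatest (productRoots rho k T) (rhoMax S) := by
  obtain ⟨⟨A, hA, hAm⟩, hup⟩ := isGreatest_rhoMax hS.isCompact hS.nonempty hS.nonneg
  constructor
  · rw [← hAm]
    exact mem_productRoots_rho (hS.nonneg A hA) (hST hA) hk
  · rintro _ ⟨B, hB, rfl⟩
    have hm0 : 0 ≤ rhoMax S := hAm ▸ rho_nonneg A
    have h := hS.rho_prod_le_pow (fun A hA => hup ⟨A, hA, rfl⟩) (L := List.ofFn B)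
      fun C hC => by
        obtain ⟨i, rfl⟩ := List.mem_ofFn.1 hC
        exact hTS (hB i)
    rw [List.length_ofFn] at h
    rw [← Real.pow_rpow_inv_natCast hm0 (show k ≠ 0 by omega), ← one_div]
    exact Real.rpow_le_rpow (rho_nonneg _) h (by positivity)

lemma IsExtremalSet.rhoMin_le_normCheckN (hS : IsExtremalSet S) (hST : S ⊆ T)
    (hTS : T ⊆ convexHull ℝ S) {ν : Seminorm ℝ (Fin N → ℝ)} (hν : ∀ x, ν x = 0 → x = 0)
    {k : ℕ} (hk : 1 ≤ k) : rhoMin S ≤ normCheckN ν k T := by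
  obtain ⟨A, hA⟩ := hS.nonempty
  refine le_csInf ⟨_, fun _ => A, fun _ => hST hA, rfl⟩ ?_
  rintro _ ⟨B, hB, rfl⟩
  refine ((hS.isLeast_productRoots hST hTS hk).2 ⟨B, hB, rfl⟩).trans
    (Real.rpow_le_rpow (rho_nonneg _) (rho_le_inducedNorm ν hν ?_) (by positivity))
  refine (prod_mulVec_ge (r := 0) (x := 0) le_rfl (List.ofFn B) fun C hC => ?_).1
  obtain ⟨i, rfl⟩ := List.mem_ofFn.1 hC
  exact ⟨hS.nonneg.convexHull _ (hTS (hB i)), by simp⟩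

/-- Squeeze between `rhoMin S` and the norm roots of powers of one minimizing matrix; the
equivalence constant `b` disappears under the `k`-th root. -/
lemma IsExtremalSet.tendsto_normCheckN (hS : IsExtremalSet S) (hST : S ⊆ T)
    (hTS : T ⊆ convexHull ℝ S) {ν : Seminorm ℝ (Fin N → ℝ)} (hν : ∀ x, ν x = 0 → x = 0) :
    Tendsto (fun k : ℕ => normCheckN ν k T) atTop (𝓝 (rhoMin S)) := by
  obtain ⟨⟨A, hA, hAm⟩, -⟩ := isLeast_rhoMin hS.isCompact hS.nonempty hS.nonneg
  obtain ⟨b, hb, hbA⟩ := exists_inducedNorm_le ν hν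
  have hup : Tendsto (fun k : ℕ => b ^ (1 / (k : ℝ)) * ‖A ^ k‖ ^ (1 / (k : ℝ))) atTop
      (𝓝 (b ^ (0 : ℝ) * rho A)) :=
    ((tendsto_const_nhds (x := b)).rpow tendsto_one_div_atTop_nhds_zero_nat
      (Or.inl hb.ne')).mul (tendsto_norm_pow_root A)
  rw [Real.rpow_zero, one_mul, hAm] at hup
  refine tendsto_of_tendsto_of_tendsto_of_le_of_le' tendsto_const_nhds hup ?_ ?_
  · filter_upwards [eventually_ge_atTop 1] with k hk
    exact hS.rhoMin_le_normCheckN hST hTS hν hk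
  · refine Eventually.of_forall fun k => ?_
    rw [← Real.mul_rpow hb.le (norm_nonneg _)]
    have hmem : inducedNorm ν (List.ofFn fun _ : Fin k => A).prod ^ (1 / (k : ℝ)) ∈
        productRoots (inducedNorm ν) k T := ⟨fun _ => A, fun _ => hST hA, rfl⟩
    refine (csInf_le ⟨0, ?_⟩ hmem).trans ?_
    · rintro _ ⟨B, -, rfl⟩
      exact Real.rpow_nonneg (inducedNorm_nonneg ν _) _
    · rw [List.ofFn_const, List.prod_replicate]
      exact Real.rpow_le_rpow (inducedNorm_nonneg ν _) (hbA _) (by positivity)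

lemma IsExtremalSet.rhoCheck_eq (hS : IsExtremalSet S) (hST : S ⊆ T)
    (hTS : T ⊆ convexHull ℝ S) {ν : Seminorm ℝ (Fin N → ℝ)} (hν : ∀ x, ν x = 0 → x = 0) :
    rhoCheck ν T = rhoMin S := by
  have hlow : ∀ x ∈ (fun k : ℕ => normCheckN ν k T) '' Set.Ici 1, rhoMin S ≤ x := by
    rintro _ ⟨k, hk, rfl⟩
    exact hS.rhoMin_le_normCheckN hST hTS hν hk
  refine le_antisymm (ge_of_tendsto (hS.tendsto_normCheckN hST hTS hν) ?_)
    (le_csInf ⟨_, 1, Set.self_mem_Ici, rfl⟩ hlow)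
  filter_upwards [eventually_ge_atTop 1] with k hk
  exact csInf_le ⟨_, hlow⟩ ⟨k, hk, rfl⟩

end Characteristics

end MatrixSets

end

theorem corollary1 {n N : ℕ} (r c : Fin n → ℕ)
    (hr : ∀ i, 0 < r i) (hc : ∀ i, 0 < c i)
    (𝒜 : (i : Fin n) → Set (Matrix (Fin (r i)) (Fin (c i)) ℝ))
    (h_nonempty : ∀ i, (𝒜 i).Nonempty)
    (h_nonneg : ∀ i, IsNonnegSet (𝒜 i))
    (h_arg : ∀ i, IsFiniteLinearlyOrdered (𝒜 i) ∨ (IsIRU (𝒜 i) ∧ IsCompact (𝒜 i)))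
    (W : Finset (AdmissibleWord r c N N)) (hW : W.Nonempty)
    (p : AdmissibleWord r c N N → ℝ) (hp : ∀ w ∈ W, 0 < p w)
    (S T : Set (Matrix (Fin N) (Fin N) ℝ))
    (hS : S = minkowskiPolynomial W p 𝒜)
    (hT : IsCompact T) (hST : S ⊆ T) (hTS : T ⊆ convexHull ℝ S)
    (ν : Seminorm ℝ (Fin N → ℝ)) (hν : ∀ x, ν x = 0 → x = 0) :
    -- the minima and maxima of the spectral radius are attained
    (IsLeast (rho '' S) (rhoMin S) ∧ IsLeast (rho '' T) (rhoMin T) ∧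
      IsGreatest (rho '' S) (rhoMax S) ∧ IsGreatest (rho '' T) (rhoMax T)) ∧
    -- the lower spectral radius
    ((∀ k : ℕ, 1 ≤ k →
        IsGLB (productRoots rho k T) (rhoCheckN k T) ∧ rhoCheckN k T = rhoMin S) ∧
      Tendsto (fun k : ℕ => normCheckN ν k T) atTop (𝓝 (rhoCheck ν T)) ∧
      Tendsto (fun k : ℕ => rhoCheckN k T) atTop (𝓝 (rhoCheck ν T)) ∧
      rhoCheck ν T = rhoMin T ∧ rhoMin T = rhoMin S) ∧
    -- the generalized spectral radius
    ((∀ k : ℕ, 1 ≤ k →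
        IsLUB (productRoots rho k T) (rhoHatN k T) ∧ rhoHatN k T = rhoMax S) ∧
      Tendsto (fun k : ℕ => rhoHatN k T) atTop (𝓝 (rhoHat T)) ∧
      rhoHat T = rhoMax T ∧ rhoMax T = rhoMax S) := by
  have : NeZero N := by
    obtain ⟨w, -⟩ := hW
    exact ⟨(w.pos hr).ne'⟩
  have harg : ∀ i, IsExtremalSet (𝒜 i) := fun i =>
    { nonempty := h_nonempty i
      isCompact := (h_arg i).elim (fun h => h.1.isCompact) fun h => h.2
      nonneg := h_nonneg i
      hasSimultaneousMin := fun s => (h_arg i).elim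
        (fun h => h.hasSimultaneousMin (h_nonempty i) s)
        fun h => h.1.hasSimultaneousMin h.2 (h_nonempty i) s }
  have hE : IsExtremalSet S := hS ▸ isExtremalSet_minkowskiPolynomial harg W hp
  have hT0 : IsNonnegSet T := fun A hA => hE.nonneg.convexHull A (hTS hA)
  have hTne : T.Nonempty := hE.nonempty.mono hST
  have hmin : ∀ k : ℕ, 1 ≤ k → IsLeast (productRoots rho k T) (rhoMin S) := fun k hk =>
    hE.isLeast_productRoots hST hTS hk
  have hmax : ∀ k : ℕ, 1 ≤ k → IsGreatest (productRoots rho k T) (rhoMax S) := fun k hk =>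
    hE.isGreatest_productRoots hST hTS hk
  have hcheck : ∀ k : ℕ, 1 ≤ k → rhoCheckN k T = rhoMin S := fun k hk => (hmin k hk).csInf_eq
  have hhat : ∀ k : ℕ, 1 ≤ k → rhoHatN k T = rhoMax S := fun k hk => (hmax k hk).csSup_eq
  -- The extrema over `T` are the case `k = 1` of the product formulas.
  have hminT : rhoMin T = rhoMin S := by
    rw [rhoMin, ← productRoots_one]
    exact hcheck 1 le_rfl
  have hmaxT : rhoMax T = rhoMax S := by
    rw [rhoMax, ← productRoots_one]
    exact hhat 1 le_rfl
  have hrhoCheck : rhoCheck ν T = rhoMin S := hE.rhoCheck_eq hST hTS hν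
  have hrhoHat : rhoHat T = rhoMax S := by
    have himage : (fun k : ℕ => rhoHatN k T) '' Set.Ici 1 = {rhoMax S} := by
      rw [Set.image_congr (g := fun _ => rhoMax S) fun k (hk : k ∈ Set.Ici 1) => hhat k hk,
        Set.nonempty_Ici.image_const]
    rw [rhoHat, himage, csSup_singleton]
  refine ⟨⟨isLeast_rhoMin hE.isCompact hE.nonempty hE.nonneg, isLeast_rhoMin hT hTne hT0,
    isGreatest_rhoMax hE.isCompact hE.nonempty hE.nonneg, isGreatest_rhoMax hT hTne hT0⟩,
    ⟨fun k hk => ⟨?_, hcheck k hk⟩, ?_, ?_, hrhoCheck.trans hminT.symm, hminT⟩,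
    ⟨fun k hk => ⟨?_, hhat k hk⟩, ?_, hrhoHat.trans hmaxT.symm, hmaxT⟩⟩
  · exact hcheck k hk ▸ (hmin k hk).isGLB
  · exact hrhoCheck ▸ hE.tendsto_normCheckN hST hTS hν
  · rw [hrhoCheck]
    exact tendsto_const_nhds.congr' ((eventually_ge_atTop 1).mono fun k hk => (hcheck k hk).symm)
  · exact hhat k hk ▸ (hmax k hk).isLUB
  · rw [hrhoHat]
    exact tendsto_const_nhds.congr' ((eventually_ge_atTop 1).mono fun k hk => (hhat k hk).symm)
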